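/- Let $n$ players and $m$ indivisible items be given, and let each player $i$ have an arbitrary utility function $u_i : 2^{\{1,\dots,m\}} \to \mathbb{R}$. Let $A^{(1)},\dots,A^{(k)}$, with $k \ge 1$, be the allowed allocations; each $A^{(j)}$ assigns to every player $i$ a bundle $A^{(j)}_i \subseteq \{1,\dots,m\}$, with $A^{(j)}_i \cap A^{(j)}_h = \emptyset$ for $i \ne h$ (items may stay unallocated). Suppose that the set of allowed allocations is swappable: for every $j$ and every pair of players $g, h$ there is an $l$ with $A^{(l)}_i = A^{(j)}_i$ for all $i \notin \{g,h\}$, $A^{(l)}_h = A^{(j)}_g$ and $A^{(l)}_g = A^{(j)}_h$. A mixed allocation is a vector $p = (p_1,\dots,p_k)$ with $p_j \ge 0$ for all $j$ and $\sum_j p_j = 1$. Then there is a mixed allocation $p$ that is both * Pareto efficient: there is no mixed allocation $p'$ such that $\sum_j p'_j u_i(A^{(j)}_i) \ge \sum_j p_j u_i(A^{(j)}_i)$ for all players $i$, with strict inequality for at least one $i$; and * envy-free: $\sum_j p_j u_i(A^{(j)}_i) \ge \sum_j p_j u_i(A^{(j)}_{i'})$ for all players $i, i'$. -/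

import Mathlib

namespace FairDivision

/-- An allocation of the indivisible items `0, …, m - 1` to the players `0, …, n - 1`: pairwise
disjoint bundles, one for each player. Items may stay unallocated. -/
structure Allocation (n m : ℕ) where
  bundle : Fin n → Finset (Fin m)
  disjoint : ∀ i h : Fin n, i ≠ h → Disjoint (bundle i) (bundle h)

/-- The allowed allocations `A 0, …, A (k - 1)` are swappable: the allocation obtained from an
allowed one by exchanging the bundles of two players is again allowed. -/
def Swappable {n m k : ℕ} (A : Fin k → Allocation n m) : Prop :=
  ∀ (j : Fin k) (g h : Fin n), ∃ l : Fin k,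
    (∀ i : Fin n, i ≠ g → i ≠ h → (A l).bundle i = (A j).bundle i) ∧
      (A l).bundle h = (A j).bundle g ∧ (A l).bundle g = (A j).bundle h

/-- A mixed allocation: a probability vector on the allowed allocations. -/
def IsMixedAllocation {k : ℕ} (p : Fin k → ℝ) : Prop :=
  (∀ j, 0 ≤ p j) ∧ ∑ j, p j = 1

/-- The expected value, in the utility of player `i`, of the random bundle that player `h`
receives under `p`. -/
def expectedUtility {n m k : ℕ} (A : Fin k → Allocation n m)
    (u : Fin n → Finset (Fin m) → ℝ) (p : Fin k → ℝ) (i h : Fin n) : ℝ :=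
  ∑ j, p j * u i ((A j).bundle h)

/-- No mixed allocation makes every player at least as well off and some player strictly
better off, in expected utility. -/
def ParetoEfficient {n m k : ℕ} (A : Fin k → Allocation n m)
    (u : Fin n → Finset (Fin m) → ℝ) (p : Fin k → ℝ) : Prop :=
  ¬ ∃ q : Fin k → ℝ, IsMixedAllocation q ∧
    (∀ i, expectedUtility A u p i i ≤ expectedUtility A u q i i) ∧
      ∃ i, expectedUtility A u p i i < expectedUtility A u q i i

/-- No player prefers, in expected utility, another player's random bundle to her own. -/
def EnvyFree {n m k : ℕ} (A : Fin k → Allocation n m)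
    (u : Fin n → Finset (Fin m) → ℝ) (p : Fin k → ℝ) : Prop :=
  ∀ i h : Fin n, expectedUtility A u p i h ≤ expectedUtility A u p i i

end FairDivision

/-! A lottery that maximizes the weighted welfare for strictly positive weights is Pareto efficient,
so it suffices to find positive weights for which some maximizing lottery is envy-free.

Let a measure on outcomes be increasing in the weighted welfare. Permuting bundles cannot raise
expected welfare, by the rearrangement inequality (`sum_mul_envy_perm_nonpos`), so envy has no
cycles; nor does a player envy one of far smaller weight (`envy_nonpos_of_le_mul`). Following envy
from a player of large weight thus ends at an unenvious player whose weight is bounded below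
(`exists_envy_nonpos_of_weight`). Hence the total envy of each player, as a vector field on the
simplex of weights, always vanishes in a positive coordinate, and a Brouwer argument
(`exists_mem_stdSimplex_forall_eq_zero`) yields weights at which nobody envies.

Brouwer needs continuity in the weights, which exact maximizers lack; so outcomes within `τ` of the
optimum are weighted continuously, and `τ → 0` by compactness. A fixed shift `ε` keeps the limiting
weights positive. The Brouwer argument itself rests on Scarf's parity lemma
`exists_colorful_primitive`. -/

namespace FairDivision

/-! ### Scarf's combinatorial lemma on primitive sets. -/

section Scarf

variable {I X : Type*}

/-- Scarf's primitive sets: no point of `X` lies strictly above the minimum of `S` in every one of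
the orders induced by `ρ i`. -/
def IsPrimitive (ρ : I → X → ℕ) (S : Finset X) : Prop :=
  ∀ y, ∃ i, ∀ x ∈ S, ρ i y ≤ ρ i x

theorem IsPrimitive.mono {ρ : I → X → ℕ} {S S' : Finset X} (h : IsPrimitive ρ S') (hS : S ⊆ S') :
    IsPrimitive ρ S := fun y => (h y).imp fun _ hi x hx => hi x (hS hx)

/-- A set of full size that misses a colour has an even number of facets with all colours
but `i₀`. -/
theorem even_card_facets [Fintype I] [DecidableEq I] [DecidableEq X]
    {c : X → I} {S : Finset X} (hS : S.card = Fintype.card I)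
    (hc : S.image c ≠ Finset.univ) (i₀ : I) {R : Finset (Finset X)}
    (hR : ∀ τ, τ ∈ R ↔ (τ.card + 1 = Fintype.card I ∧ τ.image c = Finset.univ.erase i₀) ∧ τ ⊆ S) :
    Even R.card := by
  classical
  rcases R.eq_empty_or_nonempty with rfl | ⟨τ, hτ⟩
  · simp
  obtain ⟨⟨hτc, hτi⟩, hτS⟩ := (hR τ).1 hτ
  obtain ⟨x, hxτ, rfl⟩ : ∃ x, x ∉ τ ∧ insert x τ = S :=
    Finset.exists_eq_insert_iff.2 ⟨hτS, by omega⟩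
  have hcx : c x ∈ τ.image c := by
    rw [hτi, Finset.mem_erase]
    refine ⟨fun h => hc ?_, Finset.mem_univ _⟩
    rw [Finset.image_insert, hτi, h, Finset.insert_erase (Finset.mem_univ _)]
  obtain ⟨x', hx'τ, hcx'⟩ := Finset.mem_image.1 hcx
  have hxx' : x ≠ x' := fun h => hxτ (h ▸ hx'τ)
  have hτ1 : (insert x τ).erase x = τ := Finset.erase_insert hxτ
  -- The added point `x` repeats the colour of exactly one point `x'` of `τ`; only deleting one of
  -- these two keeps all colours but `i₀`.
  have : R.card = 2 := by
    rw [Finset.card_eq_two]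
    refine ⟨(insert x τ).erase x, (insert x τ).erase x', ?_, ?_⟩
    · intro h
      have : x ∈ (insert x τ).erase x' := Finset.mem_erase.2 ⟨hxx', Finset.mem_insert_self _ _⟩
      rw [← h] at this
      exact Finset.notMem_erase _ _ this
    · ext σ
      rw [hR, Finset.mem_insert, Finset.mem_singleton]
      constructor
      · rintro ⟨⟨hσc, hσi⟩, hσS⟩
        obtain ⟨z, hzσ, hz⟩ : ∃ z, z ∉ σ ∧ insert z σ = insert x τ :=
          Finset.exists_eq_insert_iff.2 ⟨hσS, by omega⟩
        have hσ : σ = (insert x τ).erase z := by rw [← hz, Finset.erase_insert hzσ]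
        have hio : Set.InjOn c (σ : Set X) := by
          rw [← Finset.card_image_iff, hσi, Finset.card_erase_of_mem (Finset.mem_univ _),
            Finset.card_univ]
          omega
        by_cases h1 : z = x
        · exact Or.inl (h1 ▸ hσ)
        by_cases h2 : z = x'
        · exact Or.inr (h2 ▸ hσ)
        refine absurd (@hio x ?_ x' ?_ hcx'.symm) hxx'
        · rw [hσ]; simp [Ne.symm h1]
        · rw [hσ]; simp [Ne.symm h2, hx'τ]
      · rintro (rfl | rfl)
        · rw [hτ1]; exact ⟨⟨hτc, hτi⟩, hτS⟩
        · refine ⟨⟨?_, ?_⟩, Finset.erase_subset _ _⟩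
          · rw [Finset.card_erase_add_one (Finset.mem_insert_of_mem hx'τ), hS]
          · rw [← hτi]
            ext i
            simp only [Finset.mem_image, Finset.mem_erase, Finset.mem_insert]
            constructor
            · rintro ⟨w, ⟨hw, rfl | hw'⟩, rfl⟩
              · exact ⟨x', hx'τ, hcx'⟩
              · exact ⟨w, hw', rfl⟩
            · rintro ⟨w, hw, rfl⟩
              by_cases h : w = x'
              · exact ⟨x, ⟨hxx', Or.inl rfl⟩, by rw [h, hcx']⟩
              · exact ⟨w, ⟨h, Or.inr hw⟩, rfl⟩
  rw [this]
  exact even_two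

variable [Fintype X] [DecidableEq X]

/-- The pivot step: a facet `τ` whose minima in the orders `a` and `b` coincide extends to a
primitive set by a unique point that is minimal in the order `a`. -/
theorem exists_unique_pivot {ρ : I → X → ℕ} (hρ : ∀ i, Function.Injective (ρ i))
    {τ : Finset X} (hτ : IsPrimitive ρ τ) {m : I → X} (hm : ∀ i, m i ∈ τ)
    (hmin : ∀ i, ∀ x ∈ τ, ρ i (m i) ≤ ρ i x) {a b : I} (hab : a ≠ b) (hmab : m a = m b)
    (hinj : ∀ i j, i ≠ a → j ≠ a → m i = m j → i = j)
    (hne : ∃ y, ∀ j, j ≠ a → ρ j (m j) < ρ j y) :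
    ∃ x, x ∉ τ ∧ IsPrimitive ρ (insert x τ) ∧ (∀ j, j ≠ a → ρ j (m j) < ρ j x) ∧
      ∀ x', x' ∉ τ → IsPrimitive ρ (insert x' τ) → (∀ z ∈ τ, ρ a x' ≤ ρ a z) → x' = x := by
  classical
  have hsurj : ∀ z ∈ τ, ∃ j, j ≠ a ∧ m j = z := by
    intro z hz
    obtain ⟨i, hi⟩ := hτ z
    have h1 : m i = z := hρ i (le_antisymm (hmin i z hz) (hi _ (hm i)))
    by_cases h : i = a
    · exact ⟨b, hab.symm, by rw [← hmab, ← h, h1]⟩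
    · exact ⟨i, h, h1⟩
  obtain ⟨y0, hy0⟩ := hne
  -- Among the points above all minima except the one for `a`, take the highest in the order `a`;
  -- anything lower would leave `x` strictly above the enlarged set.
  obtain ⟨x, hx, hxmax⟩ := Finset.exists_max_image
    (Finset.univ.filter fun y => ∀ j, j ≠ a → ρ j (m j) < ρ j y) (ρ a) ⟨y0, by simpa using hy0⟩
  simp only [Finset.mem_filter, Finset.mem_univ, true_and] at hx hxmax
  have hxa : ∀ z ∈ τ, ρ a x ≤ ρ a z := by
    obtain ⟨i, hi⟩ := hτ x
    by_cases h : i = a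
    · exact h ▸ hi
    · exact absurd (hi _ (hm i)) (not_le.2 (hx i h))
  refine ⟨x, ?_, ?_, hx, ?_⟩
  · intro hxτ
    obtain ⟨j, hj, rfl⟩ := hsurj x hxτ
    exact lt_irrefl _ (hx j hj)
  · intro y
    by_cases h : ∀ j, j ≠ a → ρ j (m j) < ρ j y
    · refine ⟨a, fun z hz => ?_⟩
      rcases Finset.mem_insert.1 hz with rfl | hz
      · exact hxmax y h
      · exact (hxmax y h).trans (hxa z hz)
    · push Not at h
      obtain ⟨j, hj, hjy⟩ := h
      refine ⟨j, fun z hz => ?_⟩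
      rcases Finset.mem_insert.1 hz with rfl | hz
      · exact hjy.trans (hx j hj).le
      · exact hjy.trans (hmin j z hz)
  · intro x' hx'τ hprim hx'a
    have hx' : ∀ j, j ≠ a → ρ j (m j) < ρ j x' := by
      intro j hj
      by_contra hlt
      push Not at hlt
      obtain ⟨k, hk⟩ := hprim (m j)
      have hkj : k ≠ j := by
        rintro rfl
        have := hρ k (le_antisymm hlt (hk x' (Finset.mem_insert_self _ _)))
        exact hx'τ (this ▸ hm k)
      have hka : k ≠ a := by
        rintro rfl
        have := hρ k (le_antisymm (hx'a _ (hm j)) (hk x' (Finset.mem_insert_self _ _)))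
        exact hx'τ (this ▸ hm j)
      have : m k = m j := hρ k (le_antisymm (hmin k _ (hm j))
        (hk _ (Finset.mem_insert_of_mem (hm k))))
      exact hkj (hinj k j hka hj this)
    refine hρ a (le_antisymm (hxmax x' hx') ?_)
    obtain ⟨i, hi⟩ := hprim x
    by_cases h : i = a
    · subst h; exact hi x' (Finset.mem_insert_self _ _)
    · exact absurd (hi _ (Finset.mem_insert_of_mem (hm i))) (not_le.2 (hx i h))

variable [Fintype I] [DecidableEq I]

/-- An interior facet lies in exactly two primitive sets of full size. -/
theorem card_primitive_supersets_eq_two {ρ : I → X → ℕ} (hρ : ∀ i, Function.Injective (ρ i))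
    {s : I → X} (hs : ∀ i j, j ≠ i → ∀ y, y ∉ Set.range s → ρ i y < ρ i (s j))
    {τ : Finset X} (hτ : IsPrimitive ρ τ) (hcard : τ.card + 1 = Fintype.card I)
    {t : X} (ht : t ∈ τ) (hts : t ∉ Set.range s) {R : Finset (Finset X)}
    (hR : ∀ S, S ∈ R ↔ S.card = Fintype.card I ∧ IsPrimitive ρ S ∧ τ ⊆ S) :
    R.card = 2 := by
  classical
  have hmm : ∀ i, ∃ x ∈ τ, ∀ z ∈ τ, ρ i x ≤ ρ i z := fun i =>
    Finset.exists_min_image τ (ρ i) ⟨t, ht⟩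
  choose m hm hmin using hmm
  have hsurj : ∀ z ∈ τ, ∃ j, m j = z := by
    intro z hz
    obtain ⟨i, hi⟩ := hτ z
    exact ⟨i, hρ i (le_antisymm (hmin i z hz) (hi _ (hm i)))⟩
  -- There is one more order than points, and every point is some minimum, so exactly one pair of
  -- orders shares its minimum. A new point must take over one of these two.
  obtain ⟨a, -, b, -, hab, hmab⟩ := Finset.exists_ne_map_eq_of_card_lt_of_maps_to
    (s := (Finset.univ : Finset I)) (t := τ) (f := m)
    (by rw [Finset.card_univ]; omega) (fun i _ => hm i)
  have hinj : ∀ a b : I, a ≠ b → m a = m b →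
      ∀ i j, i ≠ a → j ≠ a → m i = m j → i = j := by
    intro a b hab hmab
    have himg : (Finset.univ.erase a).image m = τ := by
      ext z
      simp only [Finset.mem_image, Finset.mem_erase, Finset.mem_univ, and_true]
      refine ⟨by rintro ⟨j, -, rfl⟩; exact hm j, fun hz => ?_⟩
      obtain ⟨j, rfl⟩ := hsurj z hz
      by_cases h : j = a
      · exact ⟨b, hab.symm, by rw [← hmab, h]⟩
      · exact ⟨j, h, rfl⟩
    have hio : Set.InjOn m ((Finset.univ.erase a : Finset I) : Set I) := by
      rw [← Finset.card_image_iff, himg, Finset.card_erase_of_mem (Finset.mem_univ _),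
        Finset.card_univ]
      omega
    intro i j hi hj hij
    exact hio (by simpa using hi) (by simpa using hj) hij
  -- The non-slack point `t` makes the facet interior: the slack point `s a` beats `t`, hence the
  -- minimum, in every order but `a`.
  have hne : ∀ a : I, ∃ y, ∀ j, j ≠ a → ρ j (m j) < ρ j y := fun a =>
    ⟨s a, fun j hj => (hmin j t ht).trans_lt (hs j a hj.symm t hts)⟩
  obtain ⟨x, hxτ, hxp, hxlt, hxu⟩ := exists_unique_pivot hρ hτ hm hmin hab hmab
    (hinj a b hab hmab) (hne a)
  obtain ⟨y, hyτ, hyp, hylt, hyu⟩ := exists_unique_pivot hρ hτ hm hmin hab.symm hmab.symm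
    (hinj b a hab.symm hmab.symm) (hne b)
  have hxy : x ≠ y := by
    rintro rfl
    obtain ⟨i, hi⟩ := hτ x
    by_cases h : i = a
    · exact absurd (hi _ (hm i)) (not_le.2 (hylt i (h ▸ hab)))
    · exact absurd (hi _ (hm i)) (not_le.2 (hxlt i h))
  rw [Finset.card_eq_two]
  refine ⟨insert x τ, insert y τ, ?_, ?_⟩
  · intro h
    have : x ∈ insert y τ := h ▸ Finset.mem_insert_self x τ
    rcases Finset.mem_insert.1 this with h | h
    exacts [hxy h, hxτ h]
  · ext S
    rw [hR, Finset.mem_insert, Finset.mem_singleton]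
    constructor
    · rintro ⟨hc, hp, hsub⟩
      obtain ⟨z, hzτ, rfl⟩ : ∃ z, z ∉ τ ∧ insert z τ = S :=
        Finset.exists_eq_insert_iff.2 ⟨hsub, by omega⟩
      obtain ⟨i, hi⟩ := hp z
      have hzi : ∀ w ∈ τ, ρ i z ≤ ρ i w := fun w hw => hi w (Finset.mem_insert_of_mem hw)
      by_cases hia : i = a
      · subst hia; exact Or.inl (by rw [hxu z hzτ hp hzi])
      by_cases hib : i = b
      · subst hib; exact Or.inr (by rw [hyu z hzτ hp hzi])
      -- If `z` were minimal in a third order `i`, the point `m i` would no longer be minimal in any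
      -- order, against primitivity.
      exfalso
      obtain ⟨k, hk⟩ := hp (m i)
      have hki : m k = m i := hρ k (le_antisymm (hmin k _ (hm i))
        (hk _ (Finset.mem_insert_of_mem (hm k))))
      have : k = i := by
        by_cases hka : k = a
        · exact absurd (hinj a b hab hmab i b hia hab.symm (by rw [← hki, hka, hmab])) hib
        · exact hinj a b hab hmab k i hka hia hki
      subst this
      have := hρ k (le_antisymm (hi _ (Finset.mem_insert_of_mem (hm k)))
        (hk z (Finset.mem_insert_self _ _)))
      exact hzτ (this ▸ hm k)
    · rintro (rfl | rfl)
      · exact ⟨by rw [Finset.card_insert_of_notMem hxτ, hcard], hxp, Finset.subset_insert _ _⟩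
      · exact ⟨by rw [Finset.card_insert_of_notMem hyτ, hcard], hyp, Finset.subset_insert _ _⟩

/-- The facet of all slack points but one lies in exactly one primitive set of full size. -/
theorem card_primitive_supersets_slacks {ρ : I → X → ℕ} (hρ : ∀ i, Function.Injective (ρ i))
    {s : I → X} (hsinj : Function.Injective s) (hmin : ∀ i y, ρ i (s i) ≤ ρ i y)
    (hs : ∀ i j, j ≠ i → ∀ y, y ∉ Set.range s → ρ i y < ρ i (s j))
    (hX : ∃ y, y ∉ Set.range s) (i₀ : I) {R : Finset (Finset X)}
    (hR : ∀ S, S ∈ R ↔ S.card = Fintype.card I ∧ IsPrimitive ρ S ∧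
      (Finset.univ.erase i₀).image s ⊆ S) :
    R.card = 1 := by
  classical
  obtain ⟨y0, hy0⟩ := hX
  obtain ⟨x, hx, hxmax⟩ := Finset.exists_max_image
    (Finset.univ.filter fun y => y ∉ Set.range s) (ρ i₀) ⟨y0, by simpa using hy0⟩
  simp only [Finset.mem_filter, Finset.mem_univ, true_and] at hx hxmax
  set τ := (Finset.univ.erase i₀).image s with hτdef
  have hτcard : τ.card + 1 = Fintype.card I := by
    rw [hτdef, Finset.card_image_of_injective _ hsinj,
      Finset.card_erase_add_one (Finset.mem_univ _), Finset.card_univ]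
  have hmem : ∀ i, i ≠ i₀ → s i ∈ τ := fun i hi =>
    Finset.mem_image_of_mem _ (by simpa using hi)
  have hxτ : x ∉ τ := fun h => by
    obtain ⟨i, -, rfl⟩ := Finset.mem_image.1 h
    exact hx ⟨i, rfl⟩
  have hlt : ∀ i, ∀ y, y ∉ Set.range s → ρ i (s i) < ρ i y := fun i y hy =>
    lt_of_le_of_ne (hmin i y) fun h => hy ⟨i, hρ i h⟩
  rw [Finset.card_eq_one]
  refine ⟨insert x τ, ?_⟩
  ext S
  rw [hR, Finset.mem_singleton]
  constructor
  · rintro ⟨hc, hp, hsub⟩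
    obtain ⟨z, hzτ, rfl⟩ : ∃ z, z ∉ τ ∧ insert z τ = S :=
      Finset.exists_eq_insert_iff.2 ⟨hsub, by omega⟩
    have key : ∀ y, y ∉ Set.range s → ρ i₀ y ≤ ρ i₀ z := by
      intro y hy
      obtain ⟨i, hi⟩ := hp y
      by_cases h : i = i₀
      · subst h; exact hi z (Finset.mem_insert_self _ _)
      · exact absurd (hi _ (Finset.mem_insert_of_mem (hmem i h))) (not_le.2 (hlt i y hy))
    have hz : z ∉ Set.range s := by
      rintro ⟨i, rfl⟩
      by_cases h : i = i₀
      · subst h; exact absurd (key x hx) (not_le.2 (hlt i x hx))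
      · exact hzτ (hmem i h)
    rw [hρ i₀ (le_antisymm (hxmax z hz) (key x hx))]
  · rintro rfl
    refine ⟨by rw [Finset.card_insert_of_notMem hxτ, hτcard], ?_, Finset.subset_insert _ _⟩
    intro y
    by_cases hy : y ∈ Set.range s
    · obtain ⟨i, rfl⟩ := hy
      exact ⟨i, fun z _ => hmin i z⟩
    · refine ⟨i₀, fun z hz => ?_⟩
      rcases Finset.mem_insert.1 hz with rfl | hz
      · exact hxmax y hy
      · obtain ⟨i, hi, rfl⟩ := Finset.mem_image.1 hz
        exact (hs i₀ i (Finset.ne_of_mem_erase hi) y hy).le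

/-- Scarf's combinatorial lemma: some primitive set carries every colour exactly once. -/
theorem exists_colorful_primitive [Nonempty I] {ρ : I → X → ℕ}
    (hρ : ∀ i, Function.Injective (ρ i))
    {s : I → X} (hmin : ∀ i y, ρ i (s i) ≤ ρ i y)
    (hs : ∀ i j, j ≠ i → ∀ y, y ∉ Set.range s → ρ i y < ρ i (s j))
    (hX : ∃ y, y ∉ Set.range s) {c : X → I} (hc : ∀ i, c (s i) = i) :
    ∃ S : Finset X, IsPrimitive ρ S ∧ S.image c = Finset.univ := by
  classical
  by_contra hno
  push Not at hno
  obtain ⟨i₀⟩ := ‹Nonempty I›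
  have hsinj : Function.Injective s := Function.LeftInverse.injective hc
  -- Count incident pairs of rooms and doors modulo 2. Without a colourful room every room has
  -- evenly many doors, yet `τ₀` opens into one room and every other door into zero or two.
  let rooms : Finset (Finset X) := Finset.univ.filter fun S =>
    S.card = Fintype.card I ∧ IsPrimitive ρ S
  let doors : Finset (Finset X) := Finset.univ.filter fun τ =>
    τ.card + 1 = Fintype.card I ∧ τ.image c = Finset.univ.erase i₀
  have hcount := Finset.sum_card_bipartiteAbove_eq_sum_card_bipartiteBelow
    (s := rooms) (t := doors) (fun S τ => τ ⊆ S)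
  have hleft : Even (∑ S ∈ rooms, (doors.bipartiteAbove (fun S τ => τ ⊆ S) S).card) := by
    refine Finset.even_sum _ fun S hS => ?_
    simp only [rooms, Finset.mem_filter, Finset.mem_univ, true_and] at hS
    refine even_card_facets hS.1 (hno S hS.2) i₀ fun τ => ?_
    simp [Finset.bipartiteAbove, doors]
  set τ₀ := (Finset.univ.erase i₀).image s with hτ₀
  have hτ₀mem : τ₀ ∈ doors := by
    simp only [doors, Finset.mem_filter, Finset.mem_univ, true_and]
    constructor
    · rw [hτ₀, Finset.card_image_of_injective _ hsinj,
        Finset.card_erase_add_one (Finset.mem_univ _), Finset.card_univ]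
    · rw [hτ₀, Finset.image_image]
      have : c ∘ s = id := funext hc
      rw [this, Finset.image_id]
  rw [hcount, ← Finset.add_sum_erase _ _ hτ₀mem] at hleft
  have h1 : (rooms.bipartiteBelow (fun S τ => τ ⊆ S) τ₀).card = 1 := by
    refine card_primitive_supersets_slacks hρ hsinj hmin hs hX i₀ fun S => ?_
    simp [Finset.bipartiteBelow, rooms, hτ₀, and_assoc]
  have h2 : Even (∑ τ ∈ doors.erase τ₀, (rooms.bipartiteBelow (fun S τ => τ ⊆ S) τ).card) := by
    refine Finset.even_sum _ fun τ hτ => ?_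
    obtain ⟨hne, hτ⟩ := Finset.mem_erase.1 hτ
    simp only [doors, Finset.mem_filter, Finset.mem_univ, true_and] at hτ
    by_cases hp : IsPrimitive ρ τ
    · have ht : ∃ t ∈ τ, t ∉ Set.range s := by
        by_contra hall
        push Not at hall
        apply hne
        refine Finset.eq_of_subset_of_card_le (fun x hx => ?_) ?_
        · obtain ⟨i, rfl⟩ := hall x hx
          have := Finset.mem_image_of_mem c hx
          rw [hτ.2, hc] at this
          exact Finset.mem_image_of_mem s this
        · have := hτ.1
          have h3 := (Finset.mem_filter.1 hτ₀mem).2.1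
          omega
      obtain ⟨t, ht, hts⟩ := ht
      rw [card_primitive_supersets_eq_two hρ hs hp hτ.1 ht hts
        (R := rooms.bipartiteBelow (fun S τ => τ ⊆ S) τ)
        (fun S => by simp [Finset.bipartiteBelow, rooms, and_assoc])]
      exact even_two
    · have : rooms.bipartiteBelow (fun S τ => τ ⊆ S) τ = ∅ := by
        refine Finset.filter_eq_empty_iff.2 fun S hS hsub => hp ?_
        exact (Finset.mem_filter.1 hS).2.2.mono hsub
      simp [this]
  rw [h1] at hleft
  exact absurd hleft (by simpa [Nat.even_add_one, add_comm 1] using h2)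

end Scarf

open Filter Topology

/-! ### From Scarf's lemma to a covering form of Brouwer's theorem. -/

section Cover

variable {I : Type*} [Fintype I] [DecidableEq I]

/-- Sperner's lemma on the integer points of a simplex: near some point `m`, every colour `i` that
is not excluded by `m i = 0` occurs. -/
theorem exists_colorful_grid_cell [Nonempty I] {N : ℕ}
    (c : {x : I → ℕ // ∑ i, x i = N} → I) :
    ∃ m : I → ℕ, ∀ i, ∃ x : {x : I → ℕ // ∑ i, x i = N},
      (∀ k, m k ≤ x.1 k ∧ x.1 k ≤ m k + Fintype.card I) ∧ (c x = i ∨ m i = 0) := by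
  classical
  have hfin : Finite {x : I → ℕ // ∑ i, x i = N} := by
    refine Set.Finite.subset (Set.Finite.pi' (t := fun _ : I => Set.Iic N)
      fun _ => Set.finite_Iic N) ?_
    intro x hx i
    have hx : ∑ i, x i = N := hx
    rw [Set.mem_Iic, ← hx]
    exact Finset.single_le_sum (f := x) (fun _ _ => Nat.zero_le _) (Finset.mem_univ i)
  have := Fintype.ofFinite {x : I → ℕ // ∑ i, x i = N}
  let G := {x : I → ℕ // ∑ i, x i = N}
  obtain ⟨i₁⟩ := ‹Nonempty I›
  have hle : ∀ (x : G) (i : I), x.1 i ≤ N := by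
    intro x i
    calc x.1 i ≤ ∑ j, x.1 j :=
          Finset.single_le_sum (f := x.1) (fun _ _ => Nat.zero_le _) (Finset.mem_univ i)
      _ = N := x.2
  -- Order `i` compares `i`-th coordinates; its own slack point is below all grid points (hence the
  -- `+ 1`), the other slack points are above them. Ties are broken in `ρ` by an enumeration.
  let key : I → G ⊕ I → ℕ := fun i =>
    Sum.elim (fun x => x.1 i + 1) (fun j => if j = i then 0 else N + 2)
  let K := Fintype.card (G ⊕ I)
  let e := Fintype.equivFin (G ⊕ I)
  let ρ : I → G ⊕ I → ℕ := fun i x => key i x * K + (e x : ℕ)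
  have hlt : ∀ i x y, key i x < key i y → ρ i x < ρ i y := by
    intro i x y h
    have h1 : (key i x + 1) * K ≤ key i y * K := Nat.mul_le_mul_right _ h
    have h2 := (e x).isLt
    simp only [ρ]
    have : (key i x + 1) * K = key i x * K + K := by ring
    omega
  have hinj : ∀ i, Function.Injective (ρ i) := by
    intro i x y h
    rcases lt_trichotomy (key i x) (key i y) with h1 | h1 | h1
    · exact absurd h (hlt i x y h1).ne
    · simp only [ρ, h1] at h
      exact e.injective (Fin.ext (by omega))
    · exact absurd h (hlt i y x h1).ne'
  have hkey : ∀ i x y, ρ i x ≤ ρ i y → key i x ≤ key i y := fun i x y h =>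
    not_lt.1 fun h1 => absurd h (not_le.2 (hlt i y x h1))
  obtain ⟨S, hS, hcS⟩ := exists_colorful_primitive (I := I) (X := G ⊕ I) hinj
    (s := Sum.inr) (c := Sum.elim c id)
    (by
      intro i y
      rcases y with x | j
      · exact (hlt _ _ _ (by simp [key])).le
      · by_cases h : j = i
        · rw [h]
        · exact (hlt _ _ _ (by simp [key, h])).le)
    (by
      rintro i j hij (x | k) hy
      · refine hlt _ _ _ ?_
        have := hle x i
        simp only [key, Sum.elim_inl, Sum.elim_inr, if_neg hij]
        omega
      · exact absurd ⟨k, rfl⟩ hy)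
    ⟨Sum.inl ⟨Pi.single i₁ N, by simp⟩, by simp⟩ (fun _ => rfl)
  have hcell : ∀ y : G, ∃ i, Sum.inr i ∉ S ∧ ∀ x : G, Sum.inl x ∈ S → y.1 i ≤ x.1 i := by
    intro y
    obtain ⟨i, hi⟩ := hS (Sum.inl y)
    refine ⟨i, fun h => ?_, fun x hx => ?_⟩
    · have := hkey _ _ _ (hi _ h)
      simp [key] at this
    · have := hkey _ _ _ (hi _ hx)
      simpa [key] using this
  have hcol : ∀ i, Sum.inr i ∉ S → ∃ x : G, Sum.inl x ∈ S ∧ c x = i := by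
    intro i hi
    have : i ∈ S.image (Sum.elim c id) := by
      rw [hcS]; exact Finset.mem_univ i
    obtain ⟨x | j, hx, rfl⟩ := Finset.mem_image.1 this
    · exact ⟨x, hx, rfl⟩
    · exact absurd hx hi
  obtain ⟨i₂, hi₂, -⟩ := hcell ⟨Pi.single i₁ N, by simp⟩
  obtain ⟨x₂, hx₂, -⟩ := hcol i₂ hi₂
  have hm : ∀ i, ∃ n : ℕ, (∀ x : G, Sum.inl x ∈ S → n ≤ x.1 i) ∧
      (Sum.inr i ∈ S → n = 0) ∧ (Sum.inr i ∉ S → ∃ x : G, Sum.inl x ∈ S ∧ n = x.1 i) := by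
    intro i
    by_cases h : Sum.inr i ∈ S
    · exact ⟨0, fun _ _ => Nat.zero_le _, fun _ => rfl, fun h' => absurd h h'⟩
    · obtain ⟨x, hx, hmin⟩ := Finset.exists_min_image
        (Finset.univ.filter fun x : G => Sum.inl x ∈ S) (fun x => x.1 i) ⟨x₂, by simpa using hx₂⟩
      simp only [Finset.mem_filter, Finset.mem_univ, true_and] at hx hmin
      exact ⟨x.1 i, hmin, fun h' => absurd h' h, fun _ => ⟨x, hx, rfl⟩⟩
  choose m hmle hm0 hmx using hm
  -- Otherwise some grid point exceeds `m` in every coordinate, the surplus `d` being put on `i₁`,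
  -- which contradicts primitivity.
  have hsum : N < ∑ i, m i + Fintype.card I := by
    by_contra hcon
    push Not at hcon
    have htot : ∑ i, (m i + 1) ≤ N := by
      rw [Finset.sum_add_distrib]
      simpa using hcon
    obtain ⟨d, hd⟩ := Nat.exists_eq_add_of_le htot
    obtain ⟨i, hi, hy⟩ := hcell ⟨fun i => m i + 1 + Pi.single (M := fun _ => ℕ) i₁ d i, by
      rw [Finset.sum_add_distrib, ← hd.symm]; simp [Finset.sum_pi_single']⟩
    obtain ⟨x, hx, hmi⟩ := hmx i hi
    have := hy x hx
    simp only [← hmi] at this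
    omega
  have hclose : ∀ x : G, Sum.inl x ∈ S → ∀ k, m k ≤ x.1 k ∧ x.1 k ≤ m k + Fintype.card I := by
    intro x hx k
    refine ⟨hmle k x hx, ?_⟩
    have h1 : ∑ i ∈ Finset.univ.erase k, m i ≤ ∑ i ∈ Finset.univ.erase k, x.1 i :=
      Finset.sum_le_sum fun i _ => hmle i x hx
    have h2 := Finset.add_sum_erase Finset.univ m (Finset.mem_univ k)
    have h3 := Finset.add_sum_erase Finset.univ x.1 (Finset.mem_univ k)
    have h4 := x.2
    omega
  refine ⟨m, fun i => ?_⟩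
  by_cases hi : Sum.inr i ∈ S
  · exact ⟨x₂, hclose x₂ hx₂, Or.inr (hm0 i hi)⟩
  · obtain ⟨x, hx, hxi⟩ := hcol i hi
    exact ⟨x, hclose x hx, Or.inl hxi⟩

/-- A covering form of Brouwer's theorem: closed sets that cover the standard simplex, the `i`-th of
which contains the facet `w i = 0`, have a common point. -/
theorem exists_mem_stdSimplex_forall_mem_of_cover [Nonempty I] {F : I → Set (I → ℝ)}
    (hF : ∀ i, IsClosed (F i)) (hcover : ∀ w ∈ stdSimplex ℝ I, ∃ i, w ∈ F i)
    (hfacet : ∀ w ∈ stdSimplex ℝ I, ∀ i, w i = 0 → w ∈ F i) :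
    ∃ w ∈ stdSimplex ℝ I, ∀ i, w ∈ F i := by
  classical
  let pt : ∀ N : ℕ, {x : I → ℕ // ∑ i, x i = N + 1} → I → ℝ := fun N x i =>
    (x.1 i : ℝ) / (N + 1)
  have hpt : ∀ N x, pt N x ∈ stdSimplex ℝ I := by
    intro N x
    refine ⟨fun i => by positivity, ?_⟩
    simp only [pt]
    rw [← Finset.sum_div, ← Nat.cast_sum, x.2]
    push_cast
    exact div_self (by positivity)
  have hc : ∀ N x, ∃ i, pt N x ∈ F i := fun N x => hcover _ (hpt N x)
  choose c hc using hc
  have hcell := fun N => exists_colorful_grid_cell (c N)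
  choose m x hmx hx using hcell
  obtain ⟨i₀⟩ := ‹Nonempty I›
  obtain ⟨w, hw, φ, hφ, hlim⟩ := (isCompact_stdSimplex ℝ I).tendsto_subseq
    (x := fun N => pt N (x N i₀)) (fun N => hpt N _)
  have hinv : Tendsto (fun N : ℕ => (Fintype.card I : ℝ) / ((φ N : ℝ) + 1)) atTop (𝓝 0) := by
    have h := (tendsto_const_div_atTop_nhds_zero_nat (Fintype.card I : ℝ)).comp
      ((tendsto_add_atTop_nat 1).comp hφ.tendsto_atTop)
    refine h.congr fun N => ?_
    simp
  -- The cells shrink, so the chosen points of all colours share one limit.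
  have hlim' : ∀ i, Tendsto (fun N => pt (φ N) (x (φ N) i)) atTop (𝓝 w) := by
    intro i
    rw [tendsto_pi_nhds] at hlim ⊢
    intro k
    have hdiff : Tendsto (fun N => pt (φ N) (x (φ N) i) k - pt (φ N) (x (φ N) i₀) k)
        atTop (𝓝 0) := by
      refine squeeze_zero_norm (fun N => ?_) hinv
      simp only [pt]
      rw [← sub_div, Real.norm_eq_abs, abs_div, abs_of_pos (by positivity : (0:ℝ) < φ N + 1)]
      refine div_le_div_of_nonneg_right ?_ (by positivity)
      have h1 := hmx (φ N) i k
      have h2 := hmx (φ N) i₀ k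
      rw [abs_le]
      constructor
      · have : ((x (φ N) i₀).1 k : ℝ) ≤ (x (φ N) i).1 k + Fintype.card I := by
          exact_mod_cast h2.2.trans (Nat.add_le_add_right h1.1 _)
        linarith
      · have : ((x (φ N) i).1 k : ℝ) ≤ (x (φ N) i₀).1 k + Fintype.card I := by
          exact_mod_cast h1.2.trans (Nat.add_le_add_right h2.1 _)
        linarith
    simpa using hdiff.add (hlim k)
  refine ⟨w, hw, fun i => ?_⟩
  by_contra hwi
  -- If `w ∉ F i`, colour `i` is eventually missing, so `m i = 0`; then `w i = 0`, and the facet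
  -- condition puts `w` in `F i` after all.
  have hev : ∀ᶠ N in atTop, pt (φ N) (x (φ N) i) ∉ F i :=
    (hlim' i).eventually ((hF i).isOpen_compl.mem_nhds hwi)
  refine hwi (hfacet w hw i (tendsto_nhds_unique ((tendsto_pi_nhds.1 (hlim' i)) i) ?_))
  refine squeeze_zero' (Eventually.of_forall fun N => (hpt _ _).1 i) ?_ hinv
  filter_upwards [hev] with N hN
  simp only [pt]
  refine div_le_div_of_nonneg_right ?_ (by positivity)
  have hm0 : m (φ N) i = 0 := by
    refine (hx (φ N) i).resolve_left fun h => hN ?_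
    have := hc (φ N) (x (φ N) i)
    rwa [h] at this
  have := (hmx (φ N) i i).2
  rw [hm0, zero_add] at this
  exact_mod_cast this

/-- A continuous nonnegative vector field on the simplex that always vanishes in some positive
coordinate has a zero. -/
theorem exists_mem_stdSimplex_forall_eq_zero [Nonempty I] {e : (I → ℝ) → I → ℝ}
    (he : ∀ i, Continuous fun w => e w i) (he0 : ∀ w i, 0 ≤ e w i)
    (hpos : ∀ w ∈ stdSimplex ℝ I, ∃ i, 0 < w i ∧ e w i = 0) :
    ∃ w ∈ stdSimplex ℝ I, ∀ i, e w i = 0 := by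
  have hcont : Continuous fun w => ∑ k, e w k := continuous_finsetSum _ fun i _ => he i
  obtain ⟨w, hw, hall⟩ := exists_mem_stdSimplex_forall_mem_of_cover
    -- A common point of these sets is a fixed point of `w ↦ (w + e w) / (1 + ∑ k, e w k)`. A
    -- coordinate with `w i > 0` and `e w i = 0` then forces the sum to vanish.
    (F := fun i => {w | w i * ∑ k, e w k ≤ e w i})
    (fun i => isClosed_le ((continuous_apply i).mul hcont) (he i))
    (fun w hw => by
      by_contra hno
      simp only [Set.mem_ofPred_eq, not_exists, not_le] at hno
      have := Finset.sum_lt_sum_of_nonempty (s := Finset.univ) Finset.univ_nonempty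
        (fun i _ => hno i)
      rw [← Finset.sum_mul, hw.2, one_mul] at this
      exact lt_irrefl _ this)
    (fun w _ i hi => by simpa [hi] using he0 w i)
  refine ⟨w, hw, ?_⟩
  simp only [Set.mem_ofPred_eq] at hall
  have hsum0 : 0 ≤ ∑ k, e w k := Finset.sum_nonneg fun k _ => he0 w k
  obtain ⟨i, hi, hei⟩ := hpos w hw
  have h1 := hall i
  rw [hei] at h1
  have hzero : ∑ k, e w k = 0 := by
    refine le_antisymm ?_ hsum0
    by_contra h
    exact absurd h1 (not_le.2 (mul_pos hi (not_le.1 h)))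
  intro k
  exact (Finset.sum_eq_zero_iff_of_nonneg fun k _ => he0 w k).1 hzero k (Finset.mem_univ k)

end Cover

/-! ### Envy under welfare-monotone measures and the choice of weights. -/

section Weighted

variable {I Ω : Type*}

/-- The weighted utilitarian welfare of the outcome `ω`, where `V ω i h` is the value to player `i`
of the share of player `h`. -/
def welfare [Fintype I] (V : Ω → I → I → ℝ) (v : I → ℝ) (ω : Ω) : ℝ := ∑ i, v i * V ω i i

theorem continuous_welfare [Fintype I] (V : Ω → I → I → ℝ) (ω : Ω) :
    Continuous fun v : I → ℝ => welfare V v ω :=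
  continuous_finsetSum _ fun i _ => (continuous_apply i).mul continuous_const

/-- The (unnormalized) envy of player `i` towards player `h` under the measure `a` on outcomes. -/
def envy [Fintype Ω] (V : Ω → I → I → ℝ) (a : Ω → ℝ) (i h : I) : ℝ := ∑ ω, a ω * (V ω i h - V ω i i)

theorem envy_self [Fintype Ω] (V : Ω → I → I → ℝ) (a : Ω → ℝ) (i : I) : envy V a i i = 0 := by
  simp [envy]

theorem envy_div [Fintype Ω] (V : Ω → I → I → ℝ) (a : Ω → ℝ) (z : ℝ) (i h : I) :
    envy V (fun ω => a ω / z) i h = envy V a i h / z := by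
  simp only [envy, Finset.sum_div]
  exact Finset.sum_congr rfl fun ω _ => by ring

variable [Fintype I] [Fintype Ω] {V : Ω → I → I → ℝ} {act : Equiv.Perm I → Equiv.Perm Ω}
  {v : I → ℝ} {a : Ω → ℝ}

/-- If the measure on outcomes increases with the welfare, then no permutation of the shares
increases the expected welfare. -/
theorem sum_mul_envy_perm_nonpos (hact : ∀ σ ω i h, V (act σ ω) i h = V ω i (σ h))
    (ha : ∀ ω ω', welfare V v ω ≤ welfare V v ω' → a ω ≤ a ω') (σ : Equiv.Perm I) :
    ∑ i, v i * envy V a i (σ i) ≤ 0 := by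
  have hmono : Monovary a (welfare V v) := fun ω ω' h => ha ω ω' h.le
  have h := hmono.sum_mul_comp_perm_le_sum_mul (σ := act σ)
  have heq : ∑ i, v i * envy V a i (σ i) =
      ∑ ω, a ω * welfare V v (act σ ω) - ∑ ω, a ω * welfare V v ω := by
    simp only [envy, welfare, hact, Finset.mul_sum, ← Finset.sum_sub_distrib]
    rw [Finset.sum_comm]
    exact Finset.sum_congr rfl fun ω _ => Finset.sum_congr rfl fun i _ => by ring
  rw [heq]
  linarith

/-- A player does not envy another one of comparatively small weight. -/
theorem envy_nonpos_of_le_mul [DecidableEq I] (hact : ∀ σ ω i h, V (act σ ω) i h = V ω i (σ h))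
    (ha : ∀ ω ω', welfare V v ω ≤ welfare V v ω' → a ω ≤ a ω') (hv : ∀ i, 0 ≤ v i) {δ : ℝ}
    (hδ : ∀ ω g h, V ω g g < V ω g h → δ * |V ω h h - V ω h g| ≤ V ω g h - V ω g g)
    {g h : I} (hgh : v h ≤ δ * v g) : envy V a g h ≤ 0 := by
  by_cases hne : g = h
  · rw [hne, envy_self]
  set π := act (Equiv.swap g h) with hπ
  have hd : ∀ ω, V (π ω) g h - V (π ω) g g = -(V ω g h - V ω g g) := by
    intro ω
    rw [hact, hact, Equiv.swap_apply_left, Equiv.swap_apply_right]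
    ring
  -- `act` need not be a homomorphism, so `π` may fail to be an involution; its square still
  -- preserves welfare.
  have hW : ∀ ω, welfare V v (π (π ω)) = welfare V v ω := by
    intro ω
    simp only [welfare, hπ, hact, Equiv.swap_apply_self]
  have hincr : ∀ ω, V ω g g < V ω g h → welfare V v ω ≤ welfare V v (π ω) := by
    intro ω hω
    have hdiff : welfare V v (π ω) - welfare V v ω =
        v g * (V ω g h - V ω g g) + v h * (V ω h g - V ω h h) := by
      simp only [welfare, hπ, hact, ← Finset.sum_sub_distrib, ← mul_sub]
      rw [← Finset.sum_subset (Finset.subset_univ {g, h}), Finset.sum_pair hne,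
        Equiv.swap_apply_left, Equiv.swap_apply_right]
      intro i _ hi
      simp only [Finset.mem_insert, Finset.mem_singleton, not_or] at hi
      rw [Equiv.swap_apply_of_ne_of_ne hi.1 hi.2, sub_self, mul_zero]
    have h1 : v h * (V ω h h - V ω h g) ≤ v h * |V ω h h - V ω h g| :=
      mul_le_mul_of_nonneg_left (le_abs_self _) (hv h)
    have h2 : v h * |V ω h h - V ω h g| ≤ δ * v g * |V ω h h - V ω h g| :=
      mul_le_mul_of_nonneg_right hgh (abs_nonneg _)
    have h3 := mul_le_mul_of_nonneg_left (hδ ω g h hω) (hv g)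
    linarith
  -- Pair `ω` with `π ω`, where the gap changes sign. By `hincr` the outcome in which `g` prefers
  -- her own share gets at least as much mass.
  have htwo : envy V a g h + envy V a g h ≤ 0 := by
    have h1 : envy V a g h = ∑ ω, a (π ω) * -(V ω g h - V ω g g) := by
      rw [envy, ← Equiv.sum_comp π]
      exact Finset.sum_congr rfl fun ω _ => by rw [hd]
    nth_rewrite 2 [h1]
    rw [envy, ← Finset.sum_add_distrib]
    refine Finset.sum_nonpos fun ω _ => ?_
    have h2 : a ω * (V ω g h - V ω g g) + a (π ω) * -(V ω g h - V ω g g) =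
        (a ω - a (π ω)) * (V ω g h - V ω g g) := by ring
    rw [h2]
    rcases lt_or_ge (V ω g g) (V ω g h) with hlt | hge
    · exact mul_nonpos_of_nonpos_of_nonneg (sub_nonpos.2 (ha _ _ (hincr ω hlt)))
        (sub_nonneg.2 hlt.le)
    · rcases hge.eq_or_lt with heq | hlt
      · rw [heq, sub_self, mul_zero]
      · refine mul_nonpos_of_nonneg_of_nonpos (sub_nonneg.2 (ha _ _ ?_)) (sub_nonpos.2 hge)
        have h3 := hincr (π ω) (by linarith [hd ω])
        rwa [hW] at h3
  linarith

/-- The envy relation has no cycles: from every player a path of envy leads to a player without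
envy, and the weight decreases only by a bounded factor along the way. -/
theorem exists_envy_nonpos_of_weight (hact : ∀ σ ω i h, V (act σ ω) i h = V ω i (σ h))
    (ha : ∀ ω ω', welfare V v ω ≤ welfare V v ω' → a ω ≤ a ω') (hv : ∀ i, 0 < v i) {δ : ℝ}
    (hδ0 : 0 < δ) (hδ1 : δ ≤ 1) (hδ : ∀ g h, 0 < envy V a g h → δ * v g ≤ v h) (g : I) :
    ∃ z, (∀ h, envy V a z h ≤ 0) ∧ δ ^ Fintype.card I * v g ≤ v z := by
  classical
  have hf : ∀ i, ∃ j, ((∃ h, 0 < envy V a i h) → 0 < envy V a i j) ∧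
      ((¬∃ h, 0 < envy V a i h) → j = i) := by
    intro i
    by_cases hi : ∃ h, 0 < envy V a i h
    · obtain ⟨h, hh⟩ := hi
      exact ⟨h, fun _ => hh, fun hn => absurd ⟨h, hh⟩ hn⟩
    · exact ⟨i, fun h => absurd h hi, fun _ => rfl⟩
  choose f hf1 hf2 using hf
  have hf0 : ∀ i, 0 ≤ envy V a i (f i) := by
    intro i
    by_cases hi : ∃ h, 0 < envy V a i h
    · exact (hf1 i hi).le
    · rw [hf2 i hi, envy_self]
  have hstep : ∀ i, δ * v i ≤ v (f i) := by
    intro i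
    by_cases hi : ∃ h, 0 < envy V a i h
    · exact hδ _ _ (hf1 i hi)
    · rw [hf2 i hi]
      exact mul_le_of_le_one_left (hv i).le hδ1
  have hiter : ∀ k, δ ^ k * v g ≤ v (f^[k] g) := by
    intro k
    induction k with
    | zero => simp
    | succ k ih =>
      rw [Function.iterate_succ_apply', pow_succ', mul_assoc]
      exact (mul_le_mul_of_nonneg_left ih hδ0.le).trans (hstep _)
  obtain ⟨k, l, hkl, heq⟩ := Fintype.exists_ne_map_eq_of_card_lt
    (fun k : Fin (Fintype.card I + 1) => f^[k] g) (by simp)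
  have hper : ∀ k l : Fin (Fintype.card I + 1), (k : ℕ) < l → f^[k] g = f^[l] g →
      f^[k] g ∈ Function.periodicPts f := by
    intro k l hlt heq
    refine Function.mk_mem_periodicPts (n := l - k) (by omega) ?_
    rw [Function.IsPeriodicPt, Function.IsFixedPt, ← Function.iterate_add_apply,
      Nat.sub_add_cancel hlt.le, heq]
  obtain ⟨k, hk⟩ : ∃ k : Fin (Fintype.card I + 1), f^[k] g ∈ Function.periodicPts f := by
    rcases lt_or_gt_of_ne (fun h => hkl (Fin.ext h) : (k : ℕ) ≠ l) with h | h
    · exact ⟨k, hper k l h heq⟩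
    · exact ⟨l, hper l k h heq.symm⟩
  refine ⟨f^[k] g, ?_, ?_⟩
  · set z := f^[k] g
    -- `f` permutes its periodic points. Extended by the identity it is a permutation all of whose
    -- envy terms are nonnegative, so envy at the periodic point `z` would contradict the
    -- rearrangement inequality.
    let s : I → I := fun i => if i ∈ Function.periodicPts f then f i else i
    have hbij := Function.bijOn_periodicPts f
    have hs : Function.Injective s := by
      intro i j hij
      by_cases hi : i ∈ Function.periodicPts f <;> by_cases hj : j ∈ Function.periodicPts f <;>
        simp only [s, hi, hj, if_true, if_false] at hij
      · exact hbij.injOn hi hj hij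
      · exact absurd (hij ▸ hbij.mapsTo hi) hj
      · exact absurd (hij ▸ hbij.mapsTo hj) hi
      · exact hij
    have hcycle := sum_mul_envy_perm_nonpos hact ha
      (Equiv.ofBijective s (Finite.injective_iff_bijective.1 hs))
    by_contra hz
    push Not at hz
    have hnonneg : ∀ i, 0 ≤ v i * envy V a i (s i) := by
      intro i
      refine mul_nonneg (hv i).le ?_
      by_cases hi : i ∈ Function.periodicPts f
      · simpa only [s, hi, if_true] using hf0 i
      · simp only [s, hi, if_false, envy_self, le_refl]
    have hposz : 0 < v z * envy V a z (s z) := by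
      refine mul_pos (hv z) ?_
      simpa only [s, hk, if_true] using hf1 z hz
    exact absurd hcycle (not_le.2 (Finset.sum_pos' (fun i _ => hnonneg i)
      ⟨z, Finset.mem_univ _, hposz⟩))
  · refine le_trans ?_ (hiter k)
    exact mul_le_mul_of_nonneg_right (pow_le_pow_of_le_one hδ0.le hδ1 (by omega)) (hv g).le

/-- For each tolerance `τ` there are weights, bounded below by `ε`, and an envy-free lottery that
maximizes the weighted welfare up to `τ`. -/
theorem exists_envyFree_approx_maximizer [DecidableEq I] [Nonempty I] [Nonempty Ω]
    (hact : ∀ σ ω i h, V (act σ ω) i h = V ω i (σ h)) {δ : ℝ} (hδ0 : 0 < δ) (hδ1 : δ ≤ 1)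
    (hδ : ∀ ω g h, V ω g g < V ω g h → δ * |V ω h h - V ω h g| ≤ V ω g h - V ω g g)
    {ε : ℝ} (hε : 0 < ε) (hεδ : ε * Fintype.card I < δ ^ Fintype.card I) {τ : ℝ} (hτ : 0 < τ) :
    ∃ w ∈ stdSimplex ℝ I, ∃ p ∈ stdSimplex ℝ Ω, (∀ i h, envy V p i h ≤ 0) ∧
      ∀ ω, welfare V (fun i => w i + ε) ω - τ ≤
        ∑ ω', p ω' * welfare V (fun i => w i + ε) ω' := by
  let W : (I → ℝ) → Ω → ℝ := fun w ω => welfare V (fun i => w i + ε) ω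
  have hWc : ∀ ω, Continuous fun w => W w ω := fun ω =>
    (continuous_welfare V ω).comp (continuous_pi fun i => (continuous_apply i).add continuous_const)
  let top : (I → ℝ) → ℝ := fun w => Finset.univ.sup' Finset.univ_nonempty (W w)
  have htopc : Continuous top := Continuous.finset_sup'_apply _ fun ω _ => hWc ω
  have hle : ∀ w ω, W w ω ≤ top w := fun w ω => Finset.le_sup' (W w) (Finset.mem_univ ω)
  -- Continuous in `w`, increasing in welfare, and supported within `τ` of the optimum.
  let a : (I → ℝ) → Ω → ℝ := fun w ω => max 0 (W w ω - top w + τ)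
  have ha0 : ∀ w ω, 0 ≤ a w ω := fun w ω => le_max_left _ _
  have hac : ∀ ω, Continuous fun w => a w ω := fun ω =>
    continuous_const.max (((hWc ω).sub htopc).add continuous_const)
  have hamono : ∀ w ω ω', W w ω ≤ W w ω' → a w ω ≤ a w ω' := fun w ω ω' h =>
    max_le_max le_rfl (by linarith)
  have hec : ∀ i h, Continuous fun w => envy V (a w) i h := fun i h =>
    continuous_finsetSum _ fun ω _ => (hac ω).mul continuous_const
  obtain ⟨w, hw, hzero⟩ := exists_mem_stdSimplex_forall_eq_zero
    (e := fun w i => ∑ h, max 0 (envy V (a w) i h))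
    (fun i => continuous_finsetSum _ fun h _ => continuous_const.max (hec i h))
    (fun w i => Finset.sum_nonneg fun h _ => le_max_left _ _)
    (by
      intro w hw
      have hv : ∀ i, 0 < w i + ε := fun i => add_pos_of_nonneg_of_pos (hw.1 i) hε
      -- From a player of at least average weight, envy leads to an unenvious `z` with `w z + ε ≥ δ
      -- ^ n / n > ε`, where `n` is the number of players; so `w z > 0`.
      obtain ⟨g, hg⟩ : ∃ g, 1 ≤ Fintype.card I * w g := by
        by_contra hno
        push Not at hno
        have := Finset.sum_lt_sum_of_nonempty (s := (Finset.univ : Finset I))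
          Finset.univ_nonempty (fun i _ => hno i)
        rw [← Finset.mul_sum, hw.2] at this
        simp at this
      obtain ⟨z, hz, hzg⟩ := exists_envy_nonpos_of_weight hact (hamono w) hv hδ0 hδ1
        (fun g h hpos => by
          by_contra hlt
          exact absurd hpos (not_lt.2 (envy_nonpos_of_le_mul hact (hamono w)
            (fun i => (hv i).le) hδ (not_le.1 hlt).le))) g
      refine ⟨z, ?_, Finset.sum_eq_zero fun h _ => max_eq_left (hz h)⟩
      have hcard : (0 : ℝ) < Fintype.card I := by exact_mod_cast Fintype.card_pos
      have hpow : 0 < δ ^ Fintype.card I := pow_pos hδ0 _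
      have h1 : δ ^ Fintype.card I ≤ (w z + ε) * Fintype.card I := by
        calc δ ^ Fintype.card I ≤ δ ^ Fintype.card I * (Fintype.card I * w g) :=
              le_mul_of_one_le_right hpow.le hg
          _ ≤ δ ^ Fintype.card I * (w g + ε) * Fintype.card I := by
              nlinarith [mul_pos (mul_pos hpow hε) hcard]
          _ ≤ (w z + ε) * Fintype.card I := mul_le_mul_of_nonneg_right hzg hcard.le
      by_contra hneg
      nlinarith)
  obtain ⟨ω₀, -, hω₀⟩ := Finset.exists_mem_eq_sup' Finset.univ_nonempty (W w)
  have hZ : 0 < ∑ ω, a w ω := by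
    refine Finset.sum_pos' (fun ω _ => ha0 w ω) ⟨ω₀, Finset.mem_univ _, lt_max_of_lt_right ?_⟩
    have : top w = W w ω₀ := hω₀
    linarith
  have hp1 : ∑ ω, a w ω / ∑ ω', a w ω' = 1 := by
    rw [← Finset.sum_div]
    exact div_self hZ.ne'
  refine ⟨w, hw, fun ω => a w ω / ∑ ω', a w ω',
    ⟨fun ω => div_nonneg (ha0 w ω) hZ.le, hp1⟩, fun i h => ?_, fun ω => ?_⟩
  · rw [envy_div]
    refine div_nonpos_of_nonpos_of_nonneg ?_ hZ.le
    have := (Finset.sum_eq_zero_iff_of_nonneg fun h _ => le_max_left _ _).1 (hzero i) h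
      (Finset.mem_univ h)
    exact this ▸ le_max_right _ _
  · calc W w ω - τ ≤ top w - τ := by linarith [hle w ω]
      _ = ∑ ω', a w ω' / (∑ ω'', a w ω'') * (top w - τ) := by
          rw [← Finset.sum_mul, hp1, one_mul]
      _ ≤ ∑ ω', a w ω' / (∑ ω'', a w ω'') * W w ω' := by
          refine Finset.sum_le_sum fun ω' _ => ?_
          rcases le_or_gt (W w ω' - top w + τ) 0 with h | h
          · simp [a, max_eq_left h]
          · exact mul_le_mul_of_nonneg_left (by linarith) (div_nonneg (ha0 w ω') hZ.le)

/-- There are positive weights and an envy-free lottery that maximizes the weighted welfare. -/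
theorem exists_envyFree_maximizer [DecidableEq I] [Nonempty I] [Nonempty Ω]
    (hact : ∀ σ ω i h, V (act σ ω) i h = V ω i (σ h)) :
    ∃ v : I → ℝ, (∀ i, 0 < v i) ∧ ∃ p ∈ stdSimplex ℝ Ω, (∀ i h, envy V p i h ≤ 0) ∧
      ∀ ω, welfare V v ω ≤ ∑ ω', p ω' * welfare V v ω' := by
  obtain ⟨δ, hδ, hδ0, hδ1⟩ : ∃ δ : ℝ, (∀ ω g h, V ω g g < V ω g h →
      δ * |V ω h h - V ω h g| ≤ V ω g h - V ω g g) ∧ 0 < δ ∧ δ ≤ 1 := by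
    -- Only finitely many strict gaps occur, so one small `δ` serves them all.
    have hev : ∀ᶠ δ : ℝ in 𝓝[>] 0, ∀ ω g h, V ω g g < V ω g h →
        δ * |V ω h h - V ω h g| ≤ V ω g h - V ω g g := by
      refine eventually_all.2 fun ω => eventually_all.2 fun g => eventually_all.2 fun h => ?_
      by_cases hlt : V ω g g < V ω g h
      · have hlim : Tendsto (fun δ : ℝ => δ * |V ω h h - V ω h g|) (𝓝[>] 0) (𝓝 0) := by
          refine Tendsto.mono_left ?_ nhdsWithin_le_nhds
          exact (by fun_prop : Continuous fun δ : ℝ => δ * |V ω h h - V ω h g|).tendsto' _ _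
            (by simp)
        filter_upwards [hlim.eventually_lt_const (sub_pos.2 hlt)] with δ hδ _ using hδ.le
      · exact Eventually.of_forall fun δ h' => absurd h' hlt
    have h01 : ∀ᶠ δ : ℝ in 𝓝[>] 0, δ ∈ Set.Ioc (0 : ℝ) 1 := Ioc_mem_nhdsGT one_pos
    obtain ⟨δ, h1, h2⟩ := (hev.and h01).exists
    exact ⟨δ, h1, h2.1, h2.2⟩
  have hcard : (0 : ℝ) < Fintype.card I := by exact_mod_cast Fintype.card_pos
  have hpow : 0 < δ ^ Fintype.card I := pow_pos hδ0 _
  obtain ⟨ε, hε, hεδ⟩ : ∃ ε : ℝ, 0 < ε ∧ ε * Fintype.card I < δ ^ Fintype.card I := by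
    refine ⟨δ ^ Fintype.card I / (2 * Fintype.card I), by positivity, ?_⟩
    have : δ ^ Fintype.card I / (2 * Fintype.card I) * Fintype.card I =
        δ ^ Fintype.card I / 2 := by field_simp
    rw [this]
    linarith
  choose w hw p hp henvy hmax using fun N : ℕ =>
    exists_envyFree_approx_maximizer hact hδ0 hδ1 hδ hε hεδ
      (τ := 1 / ((N : ℝ) + 1)) (by positivity)
  obtain ⟨⟨w', p'⟩, ⟨hw', hp'⟩, φ, hφ, hlim⟩ :=
    ((isCompact_stdSimplex ℝ I).prod (isCompact_stdSimplex ℝ Ω)).tendsto_subseq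
      (x := fun N => (w N, p N)) (fun N => ⟨hw N, hp N⟩)
  have hwlim : Tendsto (fun N => w (φ N)) atTop (𝓝 w') := (continuous_fst.tendsto _).comp hlim
  have hplim : Tendsto (fun N => p (φ N)) atTop (𝓝 p') := (continuous_snd.tendsto _).comp hlim
  have hplim' : ∀ ω, Tendsto (fun N => p (φ N) ω) atTop (𝓝 (p' ω)) := tendsto_pi_nhds.1 hplim
  have hWlim : ∀ ω, Tendsto (fun N => welfare V (fun i => w (φ N) i + ε) ω) atTop
      (𝓝 (welfare V (fun i => w' i + ε) ω)) := fun ω =>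
    (((continuous_welfare V ω).comp (continuous_pi fun i =>
      (continuous_apply i).add continuous_const)).tendsto w').comp hwlim
  refine ⟨fun i => w' i + ε, fun i => add_pos_of_nonneg_of_pos (hw'.1 i) hε, p', hp',
    fun i h => ?_, fun ω => ?_⟩
  · exact le_of_tendsto (tendsto_finsetSum _ fun ω _ => (hplim' ω).mul_const _)
      (Eventually.of_forall fun N => henvy (φ N) i h)
  · have hτ : Tendsto (fun N => 1 / ((φ N : ℝ) + 1)) atTop (𝓝 0) :=
      tendsto_one_div_add_atTop_nhds_zero_nat.comp hφ.tendsto_atTop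
    have h1 := (hWlim ω).sub hτ
    rw [sub_zero] at h1
    exact le_of_tendsto_of_tendsto' h1
      (tendsto_finsetSum _ fun ω' _ => (hplim' ω').mul (hWlim ω'))
      fun N => hmax (φ N) ω

end Weighted

/-! ### Swappable families and the main theorem. -/

/-- A swappable family of allocations is closed under all permutations of the bundles. -/
theorem Swappable.exists_bundle_comp_perm {n m k : ℕ} {A : Fin k → Allocation n m}
    (hA : Swappable A) (σ : Equiv.Perm (Fin n)) (j : Fin k) :
    ∃ l, ∀ i, (A l).bundle i = (A j).bundle (σ i) := by
  induction σ using Equiv.Perm.swap_induction_on' generalizing j with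
  | one => exact ⟨j, fun i => rfl⟩
  | mul_swap f g h hgh ih =>
    obtain ⟨l, hl⟩ := ih j
    obtain ⟨l', hl', hh, hg⟩ := hA l g h
    refine ⟨l', fun i => ?_⟩
    rw [Equiv.Perm.mul_apply, ← hl]
    by_cases hig : i = g
    · rw [hig, hg, Equiv.swap_apply_left]
    by_cases hih : i = h
    · rw [hih, hh, Equiv.swap_apply_right]
    · rw [hl' i hig hih, Equiv.swap_apply_of_ne_of_ne hig hih]

end FairDivision

open FairDivision in
theorem theorem3p1 (n m k : ℕ) (hk : 0 < k) (A : Fin k → FairDivision.Allocation n m)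
    (hA : FairDivision.Swappable A) (u : Fin n → Finset (Fin m) → ℝ) :
    ∃ p : Fin k → ℝ, FairDivision.IsMixedAllocation p ∧
      FairDivision.ParetoEfficient A u p ∧ FairDivision.EnvyFree A u p := by
  classical
  rcases Nat.eq_zero_or_pos n with rfl | hn
  · refine ⟨Pi.single ⟨0, hk⟩ 1, ⟨fun j => ?_, by simp⟩, ?_, fun i => i.elim0⟩
    · by_cases h : j = ⟨0, hk⟩
      · rw [h]; simp
      · simp [h]
    · rintro ⟨-, -, -, i, -⟩
      exact i.elim0
  have : Nonempty (Fin n) := ⟨⟨0, hn⟩⟩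
  -- Outcomes are bundle functions, not indices: allocations may repeat in the list, and only on
  -- functions does composition with `σ` give a canonical bijection.
  let Ω := {B : Fin n → Finset (Fin m) // ∃ j, (A j).bundle = B}
  have : Nonempty Ω := ⟨⟨_, ⟨0, hk⟩, rfl⟩⟩
  let V : Ω → Fin n → Fin n → ℝ := fun B i h => u i (B.1 h)
  let act : Equiv.Perm (Fin n) → Equiv.Perm Ω := fun σ =>
    { toFun := fun B => ⟨B.1 ∘ σ, by
        obtain ⟨_, j, rfl⟩ := B
        exact (hA.exists_bundle_comp_perm σ j).imp fun l hl => funext hl⟩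
      invFun := fun B => ⟨B.1 ∘ σ.symm, by
        obtain ⟨_, j, rfl⟩ := B
        exact (hA.exists_bundle_comp_perm σ.symm j).imp fun l hl => funext hl⟩
      left_inv := fun B => Subtype.ext (funext fun i => by simp)
      right_inv := fun B => Subtype.ext (funext fun i => by simp) }
  obtain ⟨v, hv, p, hp, henvy, hmax⟩ := exists_envyFree_maximizer (V := V) (act := act)
    (fun _ _ _ _ => rfl)
  choose r hr using fun B : Ω => B.2
  -- The lottery is pushed forward to indices along a choice `r` of one index per outcome.
  let q : Fin k → ℝ := fun j => ∑ B, if r B = j then p B else 0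
  have hq : ∀ F : (Fin n → Finset (Fin m)) → ℝ,
      ∑ j, q j * F (A j).bundle = ∑ B, p B * F B.1 := by
    intro F
    simp only [q, Finset.sum_mul]
    rw [Finset.sum_comm]
    refine Finset.sum_congr rfl fun B _ => ?_
    simp only [ite_mul, zero_mul]
    rw [Finset.sum_ite_eq, if_pos (Finset.mem_univ _), hr]
  have hqu : ∀ i h, expectedUtility A u q i h = ∑ B, p B * V B i h := fun i h =>
    hq fun B => u i (B h)
  refine ⟨q, ⟨fun j => Finset.sum_nonneg fun B _ => ?_, ?_⟩, ?_, fun i h => ?_⟩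
  · split_ifs
    exacts [hp.1 B, le_rfl]
  · have := hq fun _ => 1
    simpa [hp.2] using this
  · rintro ⟨q', hq', hge, i, hi⟩
    have hlt : ∑ i, v i * expectedUtility A u q i i < ∑ i, v i * expectedUtility A u q' i i :=
      Finset.sum_lt_sum (fun i _ => mul_le_mul_of_nonneg_left (hge i) (hv i).le)
        ⟨i, Finset.mem_univ _, mul_lt_mul_of_pos_left hi (hv i)⟩
    have h1 : ∑ i, v i * expectedUtility A u q i i = ∑ B, p B * welfare V v B := by
      simp only [hqu, welfare, Finset.mul_sum]
      rw [Finset.sum_comm]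
      exact Finset.sum_congr rfl fun B _ => Finset.sum_congr rfl fun i _ => by ring
    have h2 : ∑ i, v i * expectedUtility A u q' i i =
        ∑ j, q' j * welfare V v ⟨(A j).bundle, j, rfl⟩ := by
      simp only [expectedUtility, welfare, Finset.mul_sum, V]
      rw [Finset.sum_comm]
      exact Finset.sum_congr rfl fun B _ => Finset.sum_congr rfl fun i _ => by ring
    have h3 : ∑ j, q' j * welfare V v ⟨(A j).bundle, j, rfl⟩ ≤ ∑ B, p B * welfare V v B := by
      calc _ ≤ ∑ j, q' j * ∑ B, p B * welfare V v B :=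
            Finset.sum_le_sum fun j _ => mul_le_mul_of_nonneg_left (hmax _) (hq'.1 j)
        _ = _ := by rw [← Finset.sum_mul, hq'.2, one_mul]
    linarith
  · have := henvy i h
    simp only [envy, mul_sub, Finset.sum_sub_distrib] at this
    rw [hqu, hqu]
    linarith
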